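/- Let $A$ be a non-empty finite alphabet, $A^*$ the set of finite words over $A$, $\varepsilon$ the empty word, $A^+=A^*\setminus\{\varepsilon\}$, and $XY=\{xy : x\in X,\ y\in Y\}$ for $X,Y\subseteq A^*$. A set $X\subseteq A^+$ is a *prefix code* (*suffix code*) if no word of $X$ is a proper prefix (resp. proper suffix) of another word of $X$, and a *bifix code* if it is both. A prefix (suffix, bifix) code is *maximal* if it is not properly contained in another prefix (resp. suffix, bifix) code over $A$. A set $X\subseteq A^*$ is *thin* if some word $w\in A^*$ is not an infix (factor) of any word of $X$. A *maximal bifix thin* code is a maximal bifix code that is thin. Let $X,Y\subseteq A^+$ be non-empty. An *alternative factorization* on $(X,Y)$ of a word $w$ is an expression $w=u_1u_2\cdots u_n$ with $n\ge 2$ whose factors are taken alternately from $X$ and from $Y$, beginning with either set: either $u_i\in X$ for all odd $i$ and $u_i\in Y$ for all even $i$, or the other way round. (Thus the choice of the set from which $u_1$ is taken fixes the set from which each factor is taken, also when $X\cap Y\neq\emptyset$.) Two alternative factorizations are *similar* if their first factors are taken from the same one of the sets $X$, $Y$, and their last factors are taken from the same one of these sets. The pair $(X,Y)$ is an *alternative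 code* if no word has two similar alternative factorizations on $(X,Y)$ with different sequences of factors. A set $Z\subseteq A^+$ is an *alt-induced code* if $Z=XY$ for some alternative code $(X,Y)$. A *prefix alt-induced code* is a set that is both an alt-induced code and a prefix code, and likewise with "maximal prefix", "suffix", "maximal suffix", "bifix" and "maximal bifix thin" in place of "prefix". **Theorem.** Let $X$ and $Y$ be non-empty subsets of $A^+$. Then: 1. $XY$ and $YX$ are both prefix alt-induced codes if and only if $X$ and $Y$ are both prefix codes; and $XY$ and $YX$ are both maximal prefix alt-induced codes if and only if $X$ and $Y$ are both maximal prefix codes. 2. $XY$ and $YX$ are both suffix alt-induced codes if and only if $X$ and $Y$ are both suffix codes; and $XY$ and $YX$ are both maximal suffix alt-induced codes if and only if $X$ and $Y$ are both maximal suffix codes. 3. $XY$ and $YX$ are both bifix alt-induced codes if and only if $X$ and $Y$ are both bifix codes; and $XY$ and $YX$ are both maximal bifix thin alt-induced codes if and only if $X$ and $Y$ are both maximal bifix thin codes. -/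

import Mathlib

/-- `X` is a set of non-empty words, i.e. a subset of `A⁺`. -/
def SubsetPlus {A : Type*} (X : Language A) : Prop := [] ∉ X

/-- `X` has at least one word. -/
def HasWord {A : Type*} (X : Language A) : Prop := ∃ w, w ∈ X

/-- A prefix code: a set of non-empty words, none of which is a proper prefix of another. -/
def IsPrefixCode {A : Type*} (X : Language A) : Prop :=
  SubsetPlus X ∧ ∀ u ∈ X, ∀ v ∈ X, u <+: v → u = v

/-- A suffix code: a set of non-empty words, none of which is a proper suffix of another. -/
def IsSuffixCode {A : Type*} (X : Language A) : Prop :=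
  SubsetPlus X ∧ ∀ u ∈ X, ∀ v ∈ X, u <:+ v → u = v

/-- A bifix code: both a prefix code and a suffix code. -/
def IsBifixCode {A : Type*} (X : Language A) : Prop := IsPrefixCode X ∧ IsSuffixCode X

/-- A maximal prefix code: a prefix code not properly contained in another prefix code. -/
def IsMaximalPrefixCode {A : Type*} (X : Language A) : Prop := Maximal IsPrefixCode X

/-- A maximal suffix code: a suffix code not properly contained in another suffix code. -/
def IsMaximalSuffixCode {A : Type*} (X : Language A) : Prop := Maximal IsSuffixCode X

/-- A maximal bifix code: a bifix code not properly contained in another bifix code. -/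
def IsMaximalBifixCode {A : Type*} (X : Language A) : Prop := Maximal IsBifixCode X

/-- `X` is thin: some word is not an infix of any word of `X`. -/
def IsThin {A : Type*} (X : Language A) : Prop := ∃ w : List A, ∀ x ∈ X, ¬ w <:+: x

/-- A maximal bifix thin code: a maximal bifix code that is thin. -/
def IsMaximalBifixThinCode {A : Type*} (X : Language A) : Prop :=
  IsMaximalBifixCode X ∧ IsThin X

/-- The component of the pair `(X, Y)` named by a label: `true` names `X`, `false` names `Y`. -/
def pairSide {A : Type*} (X Y : Language A) (s : Bool) : Language A := if s then X else Y

/-- An alternative factorization on `(X, Y)`: a sequence `u₁, …, uₙ` of words with `n ≥ 2`, taken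
alternately from `X` and from `Y`. Each word carries the label of the set it is taken from
(this matters only for words that lie in both sets). -/
structure IsAltFactorization {A : Type*} (X Y : Language A) (us : List (Bool × List A)) :
    Prop where
  two_le_length : 2 ≤ us.length
  mem_side : ∀ p ∈ us, p.2 ∈ pairSide X Y p.1
  alternates : us.IsChain (fun p q => p.1 ≠ q.1)

/-- Two factorizations are similar if they begin with words taken from the same set and end with
words taken from the same set. -/
def SimilarFactorizations {A : Type*} (us vs : List (Bool × List A)) : Prop :=
  us.head?.map Prod.fst = vs.head?.map Prod.fst ∧
    us.getLast?.map Prod.fst = vs.getLast?.map Prod.fst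

/-- The sequence of words of a factorization, without the labels. -/
def factorWords {A : Type*} (us : List (Bool × List A)) : List (List A) := us.map Prod.snd

/-- `(X, Y)` is an alternative code: `X` and `Y` are non-empty subsets of `A⁺`, and no word admits
two different similar alternative factorizations on `(X, Y)`. -/
structure IsAlternativeCode {A : Type*} (X Y : Language A) : Prop where
  subset_left : SubsetPlus X
  subset_right : SubsetPlus Y
  hasWord_left : HasWord X
  hasWord_right : HasWord Y
  unique : ∀ us vs : List (Bool × List A),
    IsAltFactorization X Y us → IsAltFactorization X Y vs → SimilarFactorizations us vs →
    (factorWords us).flatten = (factorWords vs).flatten → factorWords us = factorWords vs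

/-- `Z` is an alt-induced code: it is the product `XY` for some alternative code `(X, Y)`. -/
def IsAltInducedCode {A : Type*} (Z : Language A) : Prop :=
  ∃ X Y : Language A, IsAlternativeCode X Y ∧ Z = X * Y

/-!
Everything except the maximal bifix thin case is left-to-right parsing. If `X` and `Y` are prefix
codes, an alternative factorization is read off from left to right with no choice, because the
first label determines all the others (`isAlternativeCode_of_isPrefixCode`), and products of prefix
codes are prefix codes. Conversely a proper prefix relation `u <+: v` inside `X` gives the relation
`y ++ u <+: y ++ v` inside `Y * X`. Maximality of a non-empty prefix code means that every word is
prefix-comparable with a word of the code (`IsRightComplete`), and this passes to products; in the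
other direction, enlarging `X` would enlarge `Y * X`. The suffix statements follow by reversing all
words.

For maximal bifix thin codes the essential fact is that such a code `X` is both a maximal prefix
code and a maximal suffix code. If neither were true, with a word `y` prefix-incomparable and a word
`z` suffix-incomparable with `X`, then `y ++ z` could be added to `X`. So `X` is, up to reversal, a
maximal prefix code, and it remains to see that a thin suffix code `X` which is right complete is a
maximal suffix code (`IsRightComplete.exists_suffix_comparable`). Let `w` be an infix of no word
of `X` and suppose `u` is suffix-incomparable with every word of `X`. Parsing `(wu)ⁱw` from the left
stops inside the last `w`, so `(wu)ⁱp ∈ X*` for some prefix `p` of `w`. Only finitely many `p` are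
available, so `(wu)ⁱp` and `(wu)ʲp` lie in `X*` for some `i < j`. As `X` is a suffix code, `X*`
allows cancellation on the right, so `(wu)ʲ⁻ⁱ ∈ X*`, and its last factor in `X` is
suffix-comparable with `u`, a contradiction.
-/

section

variable {A : Type*} {X Y : Language A}

/-! ### Products and alternative factorizations of prefix codes -/

theorem SubsetPlus.mul (hX : SubsetPlus X) : SubsetPlus (X * Y) := by
  rintro h
  obtain ⟨x, hx, y, -, h⟩ := Language.mem_mul.1 h
  rw [List.append_eq_nil_iff] at h
  exact hX (h.1 ▸ hx)

/-- Two words of a prefix code that are prefixes of a common word coincide. -/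
theorem IsPrefixCode.eq_of_append_eq (hX : IsPrefixCode X) {u v s t : List A} (hu : u ∈ X)
    (hv : v ∈ X) (h : u ++ s = v ++ t) : u = v := by
  rcases List.prefix_or_prefix_of_prefix (List.prefix_append u s)
    (h ▸ List.prefix_append v t) with h' | h'
  · exact hX.2 u hu v hv h'
  · exact (hX.2 v hv u hu h').symm

theorem IsPrefixCode.mul (hX : IsPrefixCode X) (hY : IsPrefixCode Y) : IsPrefixCode (X * Y) := by
  refine ⟨hX.1.mul, fun u hu v hv huv => ?_⟩
  obtain ⟨x, hx, y, hy, rfl⟩ := Language.mem_mul.1 hu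
  obtain ⟨x', hx', y', hy', rfl⟩ := Language.mem_mul.1 hv
  obtain ⟨t, ht⟩ := huv
  rw [List.append_assoc] at ht
  obtain rfl := hX.eq_of_append_eq hx hx' ht
  rw [hY.2 y hy y' hy' ⟨t, List.append_cancel_left ht⟩]

theorem IsPrefixCode.of_mul_right (hX : SubsetPlus X) (hY₀ : HasWord Y)
    (h : IsPrefixCode (Y * X)) : IsPrefixCode X := by
  obtain ⟨y, hy⟩ := hY₀
  refine ⟨hX, fun u hu v hv huv => ?_⟩
  exact List.append_cancel_left <| h.2 (y ++ u) (Language.mem_mul.2 ⟨y, hy, u, hu, rfl⟩)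
    (y ++ v) (Language.mem_mul.2 ⟨y, hy, v, hv, rfl⟩) ((List.prefix_append_right_inj y).2 huv)

/-- Labelled factorizations of the same word over prefix codes agree as soon as their first labels
agree; neither the last labels nor a lower bound on the lengths matters. -/
theorem factorWords_eq_of_isPrefixCode (hX : IsPrefixCode X) (hY : IsPrefixCode Y) :
    ∀ us vs : List (Bool × List A),
      (∀ p ∈ us, p.2 ∈ pairSide X Y p.1) → (∀ p ∈ vs, p.2 ∈ pairSide X Y p.1) →
      us.IsChain (fun p q => p.1 ≠ q.1) → vs.IsChain (fun p q => p.1 ≠ q.1) →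
      (∀ p ∈ us.head?, ∀ q ∈ vs.head?, p.1 = q.1) →
      (factorWords us).flatten = (factorWords vs).flatten → factorWords us = factorWords vs := by
  have hside : ∀ s, IsPrefixCode (pairSide X Y s) := by
    rintro (_ | _)
    exacts [hY, hX]
  intro us
  induction us with
  | nil =>
    rintro (_ | ⟨q, vs⟩) - hv - - - h
    · rfl
    · have hq := hv q List.mem_cons_self
      simp only [factorWords, List.map_nil, List.flatten_nil, List.map_cons, List.flatten_cons,
        List.nil_eq, List.append_eq_nil_iff] at h
      exact absurd (h.1 ▸ hq) (hside q.1).1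
  | cons p us ih =>
    rintro (_ | ⟨q, vs⟩) hu hv cu cv hpq h
    · have hp := hu p List.mem_cons_self
      simp only [factorWords, List.map_nil, List.flatten_nil, List.map_cons, List.flatten_cons,
        List.append_eq_nil_iff] at h
      exact absurd (h.1 ▸ hp) (hside p.1).1
    · have hl : p.1 = q.1 := hpq p rfl q rfl
      have hp := hu p List.mem_cons_self
      have hq := hv q List.mem_cons_self
      rw [← hl] at hq
      simp only [factorWords, List.map_cons, List.flatten_cons] at h ⊢
      have hw : p.2 = q.2 := (hside p.1).eq_of_append_eq hp hq h
      rw [hw] at h ⊢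
      rw [List.isChain_cons] at cu cv
      refine congrArg _ (ih vs (fun a ha => hu a (List.mem_cons_of_mem _ ha))
        (fun a ha => hv a (List.mem_cons_of_mem _ ha)) cu.2 cv.2 (fun a ha b hb => ?_)
        (List.append_cancel_left h))
      have h₁ := cu.1 a ha
      have h₂ := cv.1 b hb
      rw [← hl] at h₂
      -- there are only two labels, and both `a.1` and `b.1` differ from `p.1`
      revert h₁ h₂
      cases p.1 <;> cases a.1 <;> cases b.1 <;> simp

theorem isAlternativeCode_of_isPrefixCode (hX : IsPrefixCode X) (hY : IsPrefixCode Y)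
    (hX₀ : HasWord X) (hY₀ : HasWord Y) : IsAlternativeCode X Y where
  subset_left := hX.1
  subset_right := hY.1
  hasWord_left := hX₀
  hasWord_right := hY₀
  unique us vs hu hv hs h := by
    refine factorWords_eq_of_isPrefixCode hX hY us vs hu.mem_side hv.mem_side hu.alternates
      hv.alternates (fun p hp q hq => ?_) h
    have := hs.1
    rw [Option.mem_def] at hp hq
    simpa [hp, hq] using this

theorem isAltInducedCode_mul_of_isPrefixCode (hX : IsPrefixCode X) (hY : IsPrefixCode Y)
    (hX₀ : HasWord X) (hY₀ : HasWord Y) : IsAltInducedCode (X * Y) :=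
  ⟨X, Y, isAlternativeCode_of_isPrefixCode hX hY hX₀ hY₀, rfl⟩

/-! ### Maximal prefix codes -/

/-- Every word is prefix-comparable with some word of `X`. For non-empty prefix codes this is
maximality. -/
def IsRightComplete (X : Language A) : Prop := ∀ w : List A, ∃ x ∈ X, w <+: x ∨ x <+: w

theorem IsPrefixCode.add_singleton (hX : IsPrefixCode X) {w : List A} (hw : w ≠ [])
    (h : ∀ x ∈ X, ¬ (w <+: x ∨ x <+: w)) : IsPrefixCode (X + {w}) := by
  refine ⟨?_, ?_⟩
  · rintro (h' | h')
    exacts [hX.1 h', hw (Set.mem_singleton_iff.1 h').symm]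
  · rintro u (hu | hu) v (hv | hv) huv
    · exact hX.2 u hu v hv huv
    · obtain rfl := Set.mem_singleton_iff.1 hv
      exact absurd (Or.inr huv) (h u hu)
    · obtain rfl := Set.mem_singleton_iff.1 hu
      exact absurd (Or.inl huv) (h v hv)
    · exact (Set.mem_singleton_iff.1 hu).trans (Set.mem_singleton_iff.1 hv).symm

theorem IsMaximalPrefixCode.isRightComplete (hX : IsMaximalPrefixCode X) (hX₀ : HasWord X) :
    IsRightComplete X := by
  intro w
  by_contra! h
  rcases eq_or_ne w [] with rfl | hw
  · obtain ⟨x, hx⟩ := hX₀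
    exact (h x hx).1 List.nil_prefix
  · have h' : ∀ x ∈ X, ¬ (w <+: x ∨ x <+: w) := fun x hx => not_or.2 (h x hx)
    have hmem : w ∈ X := hX.2 (hX.1.add_singleton hw h') (fun x hx => Or.inl hx) (Or.inr rfl)
    exact h' w hmem (Or.inl List.prefix_rfl)

theorem IsRightComplete.isMaximalPrefixCode (h : IsRightComplete X) (hX : IsPrefixCode X) :
    IsMaximalPrefixCode X := by
  refine ⟨hX, fun Z hZ hXZ w hw => ?_⟩
  obtain ⟨x, hx, h | h⟩ := h w
  · exact hZ.2 w hw x (hXZ hx) h ▸ hx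
  · exact hZ.2 x (hXZ hx) w hw h ▸ hx

theorem IsRightComplete.mul (hX : IsRightComplete X) (hY : IsRightComplete Y) :
    IsRightComplete (X * Y) := by
  intro w
  obtain ⟨x, hx, h | ⟨t, rfl⟩⟩ := hX w
  · obtain ⟨y, hy, -⟩ := hY []
    exact ⟨x ++ y, Language.mem_mul.2 ⟨x, hx, y, hy, rfl⟩, Or.inl (h.trans (List.prefix_append _ _))⟩
  · obtain ⟨y, hy, h⟩ := hY t
    refine ⟨x ++ y, Language.mem_mul.2 ⟨x, hx, y, hy, rfl⟩, ?_⟩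
    rwa [List.prefix_append_right_inj, List.prefix_append_right_inj]

theorem IsMaximalPrefixCode.mul (hX : IsMaximalPrefixCode X) (hY : IsMaximalPrefixCode Y)
    (hX₀ : HasWord X) (hY₀ : HasWord Y) : IsMaximalPrefixCode (X * Y) :=
  ((hX.isRightComplete hX₀).mul (hY.isRightComplete hY₀)).isMaximalPrefixCode (hX.1.mul hY.1)

/-- Left multiplication by a non-empty prefix code reflects inclusion. -/
theorem IsPrefixCode.le_of_mul_le_mul_left {Z : Language A} (hY : IsPrefixCode Y)
    (hY₀ : HasWord Y) (h : Y * Z ≤ Y * X) : Z ≤ X := by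
  intro z hz
  obtain ⟨y, hy⟩ := hY₀
  obtain ⟨y', hy', x, hx, h'⟩ := Language.mem_mul.1 (h (Language.mem_mul.2 ⟨y, hy, z, hz, rfl⟩))
  obtain rfl := hY.eq_of_append_eq hy' hy h'
  exact List.append_cancel_left h' ▸ hx

theorem IsMaximalPrefixCode.of_mul_right (hX : IsPrefixCode X) (hY : IsPrefixCode Y)
    (hY₀ : HasWord Y) (h : IsMaximalPrefixCode (Y * X)) : IsMaximalPrefixCode X :=
  ⟨hX, fun _ hZ hXZ => hY.le_of_mul_le_mul_left hY₀ (h.2 (hY.mul hZ) (mul_le_mul_right hXZ Y))⟩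

/-! ### Reversal -/

theorem subsetPlus_reverse : SubsetPlus X.reverse ↔ SubsetPlus X := by
  simp [SubsetPlus]

theorem hasWord_reverse : HasWord X.reverse ↔ HasWord X :=
  ⟨fun ⟨w, hw⟩ => ⟨w.reverse, hw⟩, fun ⟨w, hw⟩ => ⟨w.reverse, by simpa using hw⟩⟩

theorem isPrefixCode_reverse : IsPrefixCode X.reverse ↔ IsSuffixCode X := by
  refine and_congr subsetPlus_reverse ⟨fun h u hu v hv huv => ?_, fun h u hu v hv huv => ?_⟩
  · exact List.reverse_injective <| h u.reverse (by simpa using hu) v.reverse (by simpa using hv)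
      (List.reverse_prefix.2 huv)
  · exact List.reverse_injective <| h u.reverse hu v.reverse hv (List.reverse_suffix.2 huv)

theorem isSuffixCode_reverse : IsSuffixCode X.reverse ↔ IsPrefixCode X := by
  rw [← isPrefixCode_reverse, Language.reverse_reverse]

theorem isBifixCode_reverse : IsBifixCode X.reverse ↔ IsBifixCode X := by
  rw [IsBifixCode, isPrefixCode_reverse, isSuffixCode_reverse, and_comm, IsBifixCode]

theorem Language.reverse_mono {Z : Language A} (h : X ≤ Z) : X.reverse ≤ Z.reverse :=
  fun _ hw => h hw

/-- Reversal is an order automorphism, so it preserves maximality. -/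
theorem maximal_reverse {P Q : Language A → Prop} (hPQ : ∀ Z, P Z.reverse ↔ Q Z) :
    Maximal P X.reverse ↔ Maximal Q X := by
  refine and_congr (hPQ X) ⟨fun h Z hZ hXZ => ?_, fun h Z hZ hXZ => ?_⟩
  · have := Language.reverse_mono (h ((hPQ Z).2 hZ) (Language.reverse_mono hXZ))
    rwa [Language.reverse_reverse, Language.reverse_reverse] at this
  · have hZ' : Q Z.reverse := (hPQ _).1 (by rwa [Language.reverse_reverse])
    have hXZ' := Language.reverse_mono hXZ
    rw [Language.reverse_reverse] at hXZ'
    simpa using Language.reverse_mono (h hZ' hXZ')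

theorem isMaximalPrefixCode_reverse : IsMaximalPrefixCode X.reverse ↔ IsMaximalSuffixCode X :=
  maximal_reverse fun _ => isPrefixCode_reverse

theorem isMaximalBifixCode_reverse : IsMaximalBifixCode X.reverse ↔ IsMaximalBifixCode X :=
  maximal_reverse fun _ => isBifixCode_reverse

theorem isThin_reverse : IsThin X.reverse ↔ IsThin X := by
  refine ⟨fun ⟨w, hw⟩ => ⟨w.reverse, fun x hx h => ?_⟩, fun ⟨w, hw⟩ => ⟨w.reverse, fun x hx h => ?_⟩⟩
  · exact hw x.reverse (by simpa using hx) (by simpa using List.reverse_infix.2 h)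
  · exact hw x.reverse hx (by simpa using List.reverse_infix.2 h)

/-- The factorization of the reversed word: factors in reverse order, each one reversed, with
unchanged labels. -/
def reverseFactorization (us : List (Bool × List A)) : List (Bool × List A) :=
  (us.map (Prod.map id List.reverse)).reverse

theorem factorWords_reverseFactorization (us : List (Bool × List A)) :
    factorWords (reverseFactorization us) = ((factorWords us).map List.reverse).reverse := by
  simp [factorWords, reverseFactorization, Function.comp_def]

theorem IsAltFactorization.reverse {us : List (Bool × List A)} (h : IsAltFactorization X Y us) :
    IsAltFactorization X.reverse Y.reverse (reverseFactorization us) where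
  two_le_length := by simpa [reverseFactorization] using h.two_le_length
  mem_side p hp := by
    simp only [reverseFactorization, List.mem_reverse, List.mem_map] at hp
    obtain ⟨⟨s, w⟩, hq, rfl⟩ := hp
    have := h.mem_side _ hq
    cases s <;> simpa [pairSide] using this
  alternates := by
    rw [reverseFactorization, List.isChain_reverse, List.isChain_map]
    exact h.alternates.imp fun _ _ hab => hab.symm

theorem SimilarFactorizations.reverse {us vs : List (Bool × List A)}
    (h : SimilarFactorizations us vs) :
    SimilarFactorizations (reverseFactorization us) (reverseFactorization vs) := by
  have key : ∀ ws : List (Bool × List A),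
      (reverseFactorization ws).head?.map Prod.fst = ws.getLast?.map Prod.fst ∧
      (reverseFactorization ws).getLast?.map Prod.fst = ws.head?.map Prod.fst := by
    intro ws
    simp [reverseFactorization, Function.comp_def]
  exact ⟨by rw [(key us).1, (key vs).1, h.2], by rw [(key us).2, (key vs).2, h.1]⟩

theorem IsAlternativeCode.of_reverse (h : IsAlternativeCode X.reverse Y.reverse) :
    IsAlternativeCode X Y where
  subset_left := subsetPlus_reverse.1 h.subset_left
  subset_right := subsetPlus_reverse.1 h.subset_right
  hasWord_left := hasWord_reverse.1 h.hasWord_left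
  hasWord_right := hasWord_reverse.1 h.hasWord_right
  unique us vs hu hv hs he := by
    have := h.unique _ _ hu.reverse hv.reverse hs.reverse (by
      rw [factorWords_reverseFactorization, factorWords_reverseFactorization,
        ← List.reverse_flatten, ← List.reverse_flatten, he])
    rw [factorWords_reverseFactorization, factorWords_reverseFactorization] at this
    exact List.map_injective_iff.2 List.reverse_injective (List.reverse_injective this)

theorem isAltInducedCode_mul_of_isSuffixCode (hX : IsSuffixCode X) (hY : IsSuffixCode Y)
    (hX₀ : HasWord X) (hY₀ : HasWord Y) : IsAltInducedCode (X * Y) :=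
  ⟨X, Y, (isAlternativeCode_of_isPrefixCode (isPrefixCode_reverse.2 hX) (isPrefixCode_reverse.2 hY)
    (hasWord_reverse.2 hX₀) (hasWord_reverse.2 hY₀)).of_reverse, rfl⟩

theorem IsSuffixCode.mul (hX : IsSuffixCode X) (hY : IsSuffixCode Y) : IsSuffixCode (X * Y) := by
  rw [← isPrefixCode_reverse, Language.reverse_mul]
  exact (isPrefixCode_reverse.2 hY).mul (isPrefixCode_reverse.2 hX)

theorem IsSuffixCode.of_mul_left (hX : SubsetPlus X) (hY₀ : HasWord Y)
    (h : IsSuffixCode (X * Y)) : IsSuffixCode X := by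
  rw [← isPrefixCode_reverse, Language.reverse_mul] at h
  exact isPrefixCode_reverse.1 (h.of_mul_right (subsetPlus_reverse.2 hX) (hasWord_reverse.2 hY₀))

theorem IsMaximalSuffixCode.mul (hX : IsMaximalSuffixCode X) (hY : IsMaximalSuffixCode Y)
    (hX₀ : HasWord X) (hY₀ : HasWord Y) : IsMaximalSuffixCode (X * Y) := by
  rw [← isMaximalPrefixCode_reverse, Language.reverse_mul]
  exact (isMaximalPrefixCode_reverse.2 hY).mul (isMaximalPrefixCode_reverse.2 hX)
    (hasWord_reverse.2 hY₀) (hasWord_reverse.2 hX₀)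

theorem IsMaximalSuffixCode.of_mul_left (hX : IsSuffixCode X) (hY : IsSuffixCode Y)
    (hY₀ : HasWord Y) (h : IsMaximalSuffixCode (X * Y)) : IsMaximalSuffixCode X := by
  rw [← isMaximalPrefixCode_reverse, Language.reverse_mul] at h
  exact isMaximalPrefixCode_reverse.1 (h.of_mul_right (isPrefixCode_reverse.2 hX)
    (isPrefixCode_reverse.2 hY) (hasWord_reverse.2 hY₀))

/-! ### Thin sets and parsing -/

theorem IsThin.mul (hX : IsThin X) (hY : IsThin Y) : IsThin (X * Y) := by
  obtain ⟨v, hv⟩ := hX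
  obtain ⟨w, hw⟩ := hY
  refine ⟨v ++ w, fun z hz => ?_⟩
  obtain ⟨x, hx, y, hy, rfl⟩ := Language.mem_mul.1 hz
  rintro ⟨s, t, h⟩
  -- the boundary between `x` and `y` lies after the occurrence of `v` or before that of `w`
  have h' : (s ++ v) ++ (w ++ t) = x ++ y := by simpa using h
  obtain ⟨r, rfl, -⟩ | ⟨r, -, rfl⟩ := List.append_eq_append_iff.1 h'
  · exact hv _ hx ⟨s, r, rfl⟩
  · exact hw _ hy ⟨r, t, by simp⟩

theorem IsThin.of_mul_left (hY₀ : HasWord Y) (h : IsThin (X * Y)) : IsThin X := by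
  obtain ⟨y, hy⟩ := hY₀
  obtain ⟨w, hw⟩ := h
  exact ⟨w, fun x hx hwx => hw (x ++ y) (Language.mem_mul.2 ⟨x, hx, y, hy, rfl⟩)
    (hwx.trans (List.prefix_append x y).isInfix)⟩

/-- Every word has a left-to-right parse over a right complete set: a list of words of `X`
followed by a prefix of a word of `X`. -/
theorem IsRightComplete.exists_parse (h : IsRightComplete X) (hX : SubsetPlus X) (t : List A) :
    ∃ (L : List (List A)) (r x : List A),
      (∀ y ∈ L, y ∈ X) ∧ x ∈ X ∧ r <+: x ∧ t = L.flatten ++ r := by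
  induction hn : t.length using Nat.strong_induction_on generalizing t with
  | _ n ih =>
    obtain ⟨x, hx, htx | ⟨s, rfl⟩⟩ := h t
    · exact ⟨[], t, x, by simp, hx, htx, by simp⟩
    · have hpos : 0 < x.length := List.length_pos_of_ne_nil fun h => hX (h ▸ hx)
      obtain ⟨L, r, x', hL, hx', hr, rfl⟩ := ih s.length (by simp at hn; omega) s rfl
      exact ⟨x :: L, r, x', by simpa [hx] using hL, hx', hr, by simp⟩

/-- Right cancellation in the submonoid generated by a suffix code `X`: if `b` and `c ++ b` are
products of words of `X`, so is `c`. -/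
theorem IsSuffixCode.exists_flatten_eq (hX : IsSuffixCode X) {c : List A} (M : List (List A)) :
    ∀ L : List (List A), (∀ y ∈ L, y ∈ X) → (∀ y ∈ M, y ∈ X) → L.flatten = c ++ M.flatten →
      ∃ K : List (List A), (∀ y ∈ K, y ∈ X) ∧ K.flatten = c := by
  induction M using List.reverseRecOn with
  | nil => exact fun L hL _ h => ⟨L, hL, by simpa using h⟩
  | append_singleton M m ih =>
    intro L hL hM h
    have hm : m ∈ X := hM m (by simp)
    obtain rfl | ⟨L', l, rfl⟩ := L.eq_nil_or_concat'
    · simp only [List.flatten_nil, List.flatten_append, List.flatten_cons, List.append_nil,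
        List.nil_eq, List.append_eq_nil_iff] at h
      exact absurd (h.2.2 ▸ hm) hX.1
    · have hl : l ∈ X := hL l (by simp)
      have h' : L'.flatten ++ l = (c ++ M.flatten) ++ m := by simpa using h
      have hlm : l = m := by
        rcases List.suffix_or_suffix_of_suffix (List.suffix_append L'.flatten l)
          (h' ▸ List.suffix_append _ m) with hs | hs
        · exact hX.2 l hl m hm hs
        · exact (hX.2 m hm l hl hs).symm
      subst hlm
      exact ih L' (fun y hy => hL y (by simp [hy])) (fun y hy => hM y (by simp [hy]))
        (List.append_cancel_right h')

/-- A thin suffix code which is right complete is also left complete. -/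
theorem IsRightComplete.exists_suffix_comparable (h : IsRightComplete X) (hX : IsSuffixCode X)
    (hthin : IsThin X) (u : List A) : ∃ x ∈ X, u <:+ x ∨ x <:+ u := by
  obtain ⟨w, hw⟩ := hthin
  rcases eq_or_ne u [] with rfl | hu
  · obtain ⟨x, hx, -⟩ := h []
    exact ⟨x, hx, Or.inl List.nil_suffix⟩
  let P : ℕ → List A := fun i => (List.replicate i (w ++ u)).flatten
  have hP : ∀ i j, P (i + j) = P i ++ P j := fun i j => by
    simp only [P, List.replicate_add, List.flatten_append]
  -- since `w` is an infix of no word of `X`, the parse of `P i ++ w` stops inside the last `w`,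
  -- after its prefix of length `k`
  have hparse : ∀ i, ∃ k : Fin (w.length + 1), ∃ L : List (List A),
      (∀ y ∈ L, y ∈ X) ∧ L.flatten = P i ++ w.take k := by
    intro i
    obtain ⟨L, r, x, hL, hx, hr, he⟩ := h.exists_parse hX.1 (P i ++ w)
    obtain ⟨s, hs, hsw⟩ | ⟨s, -, rfl⟩ := List.append_eq_append_iff.1 he
    · refine ⟨⟨s.length, by simp [hsw]⟩, L, hL, ?_⟩
      simp [hs, hsw]
    · exact absurd ((List.suffix_append s w).isInfix.trans hr.isInfix) (hw x hx)
  choose k L hL hLk using hparse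
  obtain ⟨i, j, hij, hk⟩ : ∃ i j, i < j ∧ k i = k j := by
    obtain ⟨i, j, hne, hk⟩ := Finite.exists_ne_map_eq_of_infinite k
    rcases lt_or_gt_of_ne hne with hlt | hlt
    exacts [⟨i, j, hlt, hk⟩, ⟨j, i, hlt, hk.symm⟩]
  obtain ⟨d, rfl⟩ : ∃ d, j = (d + 1) + i := ⟨j - i - 1, by omega⟩
  obtain ⟨K, hK, hKP⟩ := hX.exists_flatten_eq (c := P (d + 1)) (L i) (L (d + 1 + i)) (hL _) (hL _)
    (by rw [hLk, hLk, ← hk, hP, List.append_assoc])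
  have hKu : K.flatten = (P d ++ w) ++ u := by rw [hKP, hP]; simp [P]
  obtain rfl | ⟨K', x, rfl⟩ := K.eq_nil_or_concat'
  · simp [hu] at hKu
  · refine ⟨x, hK x (by simp), ?_⟩
    have hKx : K'.flatten ++ x = (P d ++ w) ++ u := by simpa using hKu
    exact (List.suffix_or_suffix_of_suffix (List.suffix_append K'.flatten x)
      (hKx ▸ List.suffix_append _ u)).symm

/-! ### Maximal bifix thin codes -/

/-- A thin bifix code that is maximal as a prefix code is maximal as a suffix code. -/
theorem IsMaximalPrefixCode.isMaximalSuffixCode (hX : IsMaximalPrefixCode X)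
    (hs : IsSuffixCode X) (hthin : IsThin X) (hX₀ : HasWord X) : IsMaximalSuffixCode X := by
  refine ⟨hs, fun Z hZ hXZ w hw => ?_⟩
  obtain ⟨x, hx, h | h⟩ :=
    (hX.isRightComplete hX₀).exists_suffix_comparable hs hthin w
  · exact hZ.2 w hw x (hXZ hx) h ▸ hx
  · exact hZ.2 x (hXZ hx) w hw h ▸ hx

/-- If both conclusions failed, the product of a prefix-incomparable and a suffix-incomparable word
could be added to the code. -/
theorem IsMaximalBifixCode.isMaximalPrefixCode_or (hX : IsMaximalBifixCode X)
    (hX₀ : HasWord X) :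
    IsMaximalPrefixCode X ∨ IsMaximalSuffixCode X := by
  by_contra! h
  have hsX : IsPrefixCode X.reverse := isPrefixCode_reverse.2 hX.1.2
  have hp : ¬ IsRightComplete X := fun h' => h.1 (h'.isMaximalPrefixCode hX.1.1)
  have hs : ¬ IsRightComplete X.reverse := fun h' =>
    h.2 (isMaximalPrefixCode_reverse.1 (h'.isMaximalPrefixCode hsX))
  unfold IsRightComplete at hp hs
  push Not at hp hs
  obtain ⟨y, hy⟩ := hp
  obtain ⟨z, hz⟩ := hs
  -- incomparability is inherited by longer words, so `y ++ z.reverse` is incomparable on both sides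
  have hy' : ∀ x ∈ X, ¬ (y ++ z.reverse <+: x ∨ x <+: y ++ z.reverse) := by
    rintro x hx (h' | h')
    · exact (hy x hx).1 ((List.prefix_append _ _).trans h')
    · rcases List.prefix_or_prefix_of_prefix h' (List.prefix_append y _) with h' | h'
      exacts [(hy x hx).2 h', (hy x hx).1 h']
  have hz' : ∀ x ∈ X.reverse, ¬ (z ++ y.reverse <+: x ∨ x <+: z ++ y.reverse) := by
    rintro x hx (h' | h')
    · exact (hz x hx).1 ((List.prefix_append _ _).trans h')
    · rcases List.prefix_or_prefix_of_prefix h' (List.prefix_append z _) with h' | h'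
      exacts [(hz x hx).2 h', (hz x hx).1 h']
  obtain ⟨x, hx⟩ := hX₀
  have hne : y ++ z.reverse ≠ [] := fun h' => (hy' x hx) (Or.inl (h' ▸ List.nil_prefix))
  have hrev : (X + {y ++ z.reverse}).reverse = X.reverse + {z ++ y.reverse} := by
    ext v
    rw [Language.mem_reverse, Language.mem_add, Language.mem_add, Language.mem_reverse]
    refine or_congr Iff.rfl ?_
    change v.reverse = y ++ z.reverse ↔ v = z ++ y.reverse
    simp [List.reverse_eq_iff]
  have hbifix : IsBifixCode (X + {y ++ z.reverse}) :=
    ⟨hX.1.1.add_singleton hne hy', isPrefixCode_reverse.1 <| hrev ▸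
      hsX.add_singleton (by simpa [and_comm] using hne) hz'⟩
  have hmem : y ++ z.reverse ∈ X := hX.2 hbifix (fun v hv => Or.inl hv) (Or.inr rfl)
  exact hy' _ hmem (Or.inl List.prefix_rfl)

theorem IsMaximalBifixThinCode.isMaximalPrefixCode (hX : IsMaximalBifixThinCode X)
    (hX₀ : HasWord X) : IsMaximalPrefixCode X := by
  rcases hX.1.isMaximalPrefixCode_or hX₀ with h | h
  · exact h
  · rw [← Language.reverse_reverse X, isMaximalPrefixCode_reverse]
    exact (isMaximalPrefixCode_reverse.2 h).isMaximalSuffixCode (isSuffixCode_reverse.2 hX.1.1.1)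
      (isThin_reverse.2 hX.2) (hasWord_reverse.2 hX₀)

theorem IsBifixCode.mul (hX : IsBifixCode X) (hY : IsBifixCode Y) : IsBifixCode (X * Y) :=
  ⟨hX.1.mul hY.1, hX.2.mul hY.2⟩

theorem IsMaximalBifixThinCode.mul (hX : IsMaximalBifixThinCode X)
    (hY : IsMaximalBifixThinCode Y) (hX₀ : HasWord X) (hY₀ : HasWord Y) :
    IsMaximalBifixThinCode (X * Y) := by
  have h := (hX.isMaximalPrefixCode hX₀).mul (hY.isMaximalPrefixCode hY₀) hX₀ hY₀
  exact ⟨⟨hX.1.1.mul hY.1.1, fun Z hZ hle => h.2 hZ.1 hle⟩, hX.2.mul hY.2⟩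

theorem IsMaximalBifixThinCode.of_mul (hX : IsBifixCode X) (hY : IsBifixCode Y)
    (hY₀ : HasWord Y) (h : IsMaximalBifixThinCode (X * Y)) (h' : IsMaximalBifixThinCode (Y * X)) :
    IsMaximalBifixThinCode X :=
  ⟨⟨hX, fun _ hZ hXZ => hY.1.le_of_mul_le_mul_left hY₀
    (h'.1.2 (hY.mul hZ) (mul_le_mul_right hXZ Y))⟩, h.2.of_mul_left hY₀⟩

theorem IsBifixCode.of_mul (hX : SubsetPlus X) (hY₀ : HasWord Y) (h : IsBifixCode (X * Y))
    (h' : IsBifixCode (Y * X)) : IsBifixCode X :=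
  ⟨h'.1.of_mul_right hX hY₀, h.2.of_mul_left hX hY₀⟩

end

/-! ### Characterizations of the products `X * Y` and `Y * X` -/

theorem mainTheorem2 {A : Type*} [Finite A] (X Y : Language A)
    (hX : SubsetPlus X) (hY : SubsetPlus Y) (hX₀ : HasWord X) (hY₀ : HasWord Y) :
    (((IsAltInducedCode (X * Y) ∧ IsPrefixCode (X * Y)) ∧
        (IsAltInducedCode (Y * X) ∧ IsPrefixCode (Y * X))) ↔
      (IsPrefixCode X ∧ IsPrefixCode Y)) ∧
    (((IsAltInducedCode (X * Y) ∧ IsMaximalPrefixCode (X * Y)) ∧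
        (IsAltInducedCode (Y * X) ∧ IsMaximalPrefixCode (Y * X))) ↔
      (IsMaximalPrefixCode X ∧ IsMaximalPrefixCode Y)) ∧
    (((IsAltInducedCode (X * Y) ∧ IsSuffixCode (X * Y)) ∧
        (IsAltInducedCode (Y * X) ∧ IsSuffixCode (Y * X))) ↔
      (IsSuffixCode X ∧ IsSuffixCode Y)) ∧
    (((IsAltInducedCode (X * Y) ∧ IsMaximalSuffixCode (X * Y)) ∧
        (IsAltInducedCode (Y * X) ∧ IsMaximalSuffixCode (Y * X))) ↔
      (IsMaximalSuffixCode X ∧ IsMaximalSuffixCode Y)) ∧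
    (((IsAltInducedCode (X * Y) ∧ IsBifixCode (X * Y)) ∧
        (IsAltInducedCode (Y * X) ∧ IsBifixCode (Y * X))) ↔
      (IsBifixCode X ∧ IsBifixCode Y)) ∧
    (((IsAltInducedCode (X * Y) ∧ IsMaximalBifixThinCode (X * Y)) ∧
        (IsAltInducedCode (Y * X) ∧ IsMaximalBifixThinCode (Y * X))) ↔
      (IsMaximalBifixThinCode X ∧ IsMaximalBifixThinCode Y)) := by
  have altP : IsPrefixCode X → IsPrefixCode Y →
      IsAltInducedCode (X * Y) ∧ IsAltInducedCode (Y * X) := fun h k =>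
    ⟨isAltInducedCode_mul_of_isPrefixCode h k hX₀ hY₀,
      isAltInducedCode_mul_of_isPrefixCode k h hY₀ hX₀⟩
  have altS : IsSuffixCode X → IsSuffixCode Y →
      IsAltInducedCode (X * Y) ∧ IsAltInducedCode (Y * X) := fun h k =>
    ⟨isAltInducedCode_mul_of_isSuffixCode h k hX₀ hY₀,
      isAltInducedCode_mul_of_isSuffixCode k h hY₀ hX₀⟩
  refine ⟨⟨?_, ?_⟩, ⟨?_, ?_⟩, ⟨?_, ?_⟩, ⟨?_, ?_⟩, ⟨?_, ?_⟩, ⟨?_, ?_⟩⟩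
  · rintro ⟨⟨-, h⟩, -, k⟩
    exact ⟨k.of_mul_right hX hY₀, h.of_mul_right hY hX₀⟩
  · rintro ⟨h, k⟩
    exact ⟨⟨(altP h k).1, h.mul k⟩, (altP h k).2, k.mul h⟩
  · rintro ⟨⟨-, h⟩, -, k⟩
    have pX := k.1.of_mul_right hX hY₀
    have pY := h.1.of_mul_right hY hX₀
    exact ⟨k.of_mul_right pX pY hY₀, h.of_mul_right pY pX hX₀⟩
  · rintro ⟨h, k⟩
    exact ⟨⟨(altP h.1 k.1).1, h.mul k hX₀ hY₀⟩, (altP h.1 k.1).2, k.mul h hY₀ hX₀⟩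
  · rintro ⟨⟨-, h⟩, -, k⟩
    exact ⟨h.of_mul_left hX hY₀, k.of_mul_left hY hX₀⟩
  · rintro ⟨h, k⟩
    exact ⟨⟨(altS h k).1, h.mul k⟩, (altS h k).2, k.mul h⟩
  · rintro ⟨⟨-, h⟩, -, k⟩
    have sX := h.1.of_mul_left hX hY₀
    have sY := k.1.of_mul_left hY hX₀
    exact ⟨h.of_mul_left sX sY hY₀, k.of_mul_left sY sX hX₀⟩
  · rintro ⟨h, k⟩
    exact ⟨⟨(altS h.1 k.1).1, h.mul k hX₀ hY₀⟩, (altS h.1 k.1).2, k.mul h hY₀ hX₀⟩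
  · rintro ⟨⟨-, h⟩, -, k⟩
    exact ⟨h.of_mul hX hY₀ k, k.of_mul hY hX₀ h⟩
  · rintro ⟨h, k⟩
    exact ⟨⟨(altP h.1 k.1).1, h.mul k⟩, (altP h.1 k.1).2, k.mul h⟩
  · rintro ⟨⟨-, h⟩, -, k⟩
    have bX := h.1.1.of_mul hX hY₀ k.1.1
    have bY := k.1.1.of_mul hY hX₀ h.1.1
    exact ⟨h.of_mul bX bY hY₀ k, k.of_mul bY bX hX₀ h⟩
  · rintro ⟨h, k⟩
    have alt := altP h.1.1.1 k.1.1.1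
    exact ⟨⟨alt.1, h.mul k hX₀ hY₀⟩, alt.2, k.mul h hY₀ hX₀⟩
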